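/- Fix integers $m\ge 0$ (propagation delay in slots), $K\ge 0$ (retry limit) and contention windows $W_0,\dots,W_K\ge 1$ with $W_s\le W_K$ for all $s$ and $W_K\ge 2$. Consider two nodes, a tagged node and another one. For a window $W$, an integer $d$ with $|d|\le m$, and $\beta\in[0,1]$, let $l$ be uniform on $\{1,\dots,W\}$ and let $w\ge1$ be independent of $l$ with $P(w=j)=(1-\beta)^{j-1}\beta$ ($w=\infty$ if $\beta=0$). Here $l$ is the tagged node's backoff, $w$ is the slot of the other node's first attempt, counted from the start of its backoff, and $d$ is the number of slots by which the tagged node starts its backoff later than the other node. Put $r(l)=\max(l+d-m-1,0)$. The tagged node is interrupted iff $w\le r(l)$; then it has counted $w+m-d$ slots and has a residual backoff of $l+d-w-m$. Otherwise it completes its backoff after counting $l$ slots; it succeeds if $w>l+d+m$, and it collides with new misalignment $e=w-(l+d)\in\{-m,\dots,m\}$ if $w\le l+d+m$. Accordingly put $$P_I(W,d,\beta)=\frac1W\sum_{l=1}^{W}\bigl[1-(1-\beta)^{r(l)}\bigr],\qquad E_r(W,d,\beta)=\frac1W\sum_{l=1}^{W}\sum_{w=1}^{r(l)}(1-\beta)^{w-1}\beta\,(l+d-w-m),$$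 $$E_f(W,d,\beta)=\frac1W\sum_{l=1}^{W}\Bigl[(1-\beta)^{r(l)}\,l+\sum_{w=1}^{r(l)}(1-\beta)^{w-1}\beta\,(w+m-d)\Bigr].$$ For an outcome $x\in\{0_s\}\cup\{-m,\dots,m\}$ (success, or collision with misalignment $x$; the collision outcome $0$ is also written $0_c$) and an integer $L$, let $g_\beta(L,0_s)=(1-\beta)^{L+m}$ and $g_\beta(L,e)=(1-\beta)^{L+e-1}\beta\,\mathbf 1_{L+e\ge1}$. Let $\beta_s=\beta_s(\beta_d)=\dfrac{1-P_I(W_0,0,\beta_d)}{E_f(W_0,0,\beta_d)}$, and define $h(b,x)$ recursively for $b\ge1$ by $$h(b,x)=g_{\beta_s}(b,x)+\sum_{1\le w\le b-m-1}(1-\beta_s)^{w-1}\beta_s\,h(b-w-m,x).$$ The embedded chain of the tagged node has the states $(0,0_s)$ and $(s,d)$, $0\le s\le K$, $-m\le d\le m$. In the state $(0,0_s)$ put $s=0$, $d=0$, $\beta=\beta_d$; in a state $(s,d)$ put $\beta=\beta_c$. From a state with parameters $s,d,\beta$, the outcome $x$ has probability $$\frac1{W_s}\sum_{l=1}^{W_s}\Bigl[g_\beta(l+d,x)+\sum_{w=1}^{r(l)}(1-\beta)^{w-1}\beta\,h(l+d-w-m,x)\Bigr],$$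 and the chain moves to $(0,0_s)$ if $x=0_s$ and to $((s+1)\bmod(K+1),x)$ otherwise. Then there is a pair $(\beta_d,\beta_c)\in[1/W_K,1]^2$ for which this chain has a unique stationary distribution $\psi$, and $$\beta_d=\frac{\sum_{p}\psi(p)P_I(p)}{\sum_{p}\psi(p)E_r(p)},\qquad \beta_c=\frac{\sum_{p\ne(0,0_s)}\psi(p)(1-P_I(p))}{\sum_{p\ne(0,0_s)}\psi(p)E_f(p)},$$ with nonzero denominators, where the sums run over the states $p$ and $P_I(p)=P_I(W_s,d,\beta)$, and likewise $E_r(p)$, $E_f(p)$, with the parameters $s,d,\beta$ of the state $p$. -/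

import Mathlib

/-!
Two saturated nodes, propagation delay of `m` slots, backoff stages `0, …, K`, contention windows
`W 0, …, W K`. A tagged node samples its backoffs uniformly from its current contention window; the
other node makes Bernoulli attempts.

Relative misalignments are coded by integers `d` with `-m ≤ d ≤ m`: `d = k > 0` is the misalignment
`+k` (the tagged node starts its backoff `k` slots after the other one), `d = -k < 0` is `-k` (the
tagged node starts `k` slots before the other one), and `d = 0` is `0_c` (aligned after a
collision). The misalignment `0_s` (aligned after a success of the tagged node) is kept apart as
`none`.

Time is counted in slots of the other node's backoff. If the tagged node has misalignment `d` and
backoff `l`, it is due to attempt at slot `L = l + d`. With the other node first attempting at its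
slot `w ≥ 1`, the tagged node
* is interrupted if `w ≤ L - m - 1`, having counted `w + m - d` slots, with `L - (w + m)` left;
* collides if `L - m ≤ w ≤ L + m`, and its next misalignment is then `w - L`;
* succeeds if `w > L + m`.
-/

noncomputable section

namespace DCF

/-- The relative misalignments `0_c, ±1, …, ±m`. -/
abbrev Offset (m : ℕ) : Type := ↥(Finset.Icc (-(m : ℤ)) (m : ℤ))

/-- The relative misalignments `0_s` (`none`) and `0_c, ±1, …, ±m`. -/
abbrev Misalignment (m : ℕ) : Type := Option (Offset m)

/-- States of the embedded chain of the tagged node: `none` is `(0, 0_s)`, and `some (s, d)` is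
backoff stage `s` with misalignment `d` after a collision. (A success resets the stage, so `0_s`
occurs with stage `0` only.) -/
abbrev State (K m : ℕ) : Type := Option (Fin (K + 1) × Offset m)

/-- Number of slots in which an attempt of the other node interrupts the tagged node, when the
latter has misalignment `d` and backoff `l`: the positive part of `l + d - m - 1`. -/
def slots (m : ℕ) (d : ℤ) (l : ℕ) : ℕ := ((l : ℤ) + d - m - 1).toNat

/-- The tagged node is due to attempt at slot `L`, the other node attempts with probability `β` in
each slot: probability that the tagged node is not interrupted and that its attempt leads to the
misalignment `x`. -/
def direct (m : ℕ) (β : ℝ) (L : ℤ) : Misalignment m → ℝ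
  | none => (1 - β) ^ (L + m).toNat
  | some e => if 1 ≤ L + (e : ℤ) then (1 - β) ^ (L + (e : ℤ) - 1).toNat * β else 0

/-- `h(b, x)`: probability that the backoff completion of the tagged node leads to the misalignment
`x`, given that it resumes with residual backoff `b` after an interruption. The other node then
attempts with probability `βs`, at slot `w + 1` in the sum, and the sum is empty if `b < m + 2`. -/
def h (m : ℕ) (βs : ℝ) (x : Misalignment m) (b : ℕ) : ℝ :=
  direct m βs b x +
    ∑ w : Fin (b - m - 1), (1 - βs) ^ (w : ℕ) * βs * h m βs x (b - ((w : ℕ) + 1 + m))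
termination_by b
decreasing_by have := w.isLt; omega

/-- `P_I`: probability that the tagged node is interrupted in a backoff cycle with contention
window `W` and misalignment `d`, the other node attempting with probability `β`. -/
def probInterrupted (m W : ℕ) (d : ℤ) (β : ℝ) : ℝ :=
  (1 / (W : ℝ)) * ∑ l ∈ Finset.Icc 1 W, (1 - (1 - β) ^ slots m d l)

/-- `E B_r`: mean residual backoff from the first interruption to the backoff completion (zero if
there is no interruption). -/
def meanResidual (m W : ℕ) (d : ℤ) (β : ℝ) : ℝ :=
  (1 / (W : ℝ)) * ∑ l ∈ Finset.Icc 1 W, ∑ w ∈ Finset.Icc 1 (slots m d l),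
    (1 - β) ^ (w - 1) * β * ((l : ℝ) + (d : ℝ) - ((w : ℝ) + (m : ℝ)))

/-- `E B_s` and `E B_c`: mean backoff counted by the tagged node until it is interrupted or
completes its backoff, whichever is earlier. -/
def meanFirst (m W : ℕ) (d : ℤ) (β : ℝ) : ℝ :=
  (1 / (W : ℝ)) * ∑ l ∈ Finset.Icc 1 W, ((1 - β) ^ slots m d l * (l : ℝ) +
    ∑ w ∈ Finset.Icc 1 (slots m d l), (1 - β) ^ (w - 1) * β * ((w : ℝ) + (m : ℝ) - (d : ℝ)))

section Chain

variable {K m : ℕ}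

/-- Backoff stage of a state. -/
def stage : State K m → Fin (K + 1)
  | none => 0
  | some p => p.1

/-- Misalignment of a state, as an integer (`0` for `0_s` and for `0_c`). -/
def offset : State K m → ℤ
  | none => 0
  | some p => (p.2 : ℤ)

/-- Attempt probability of the other node in the first transmission cycle of a backoff cycle that
starts in the given state: `β_d` after a success of the tagged node, `β_c` after a collision. -/
def rate (βd βc : ℝ) : State K m → ℝ
  | none => βd
  | some _ => βc

/-- `β_s`, as a function of `β_d`. -/
def betaS (W : Fin (K + 1) → ℕ) (m : ℕ) (βd : ℝ) : ℝ :=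
  (1 - probInterrupted m (W 0) 0 βd) / meanFirst m (W 0) 0 βd

/-- `P_nI`: probability that a backoff cycle starting in state `p` has no interruption and ends
with misalignment `x`. -/
def probNotInterrupted (W : Fin (K + 1) → ℕ) (βd βc : ℝ) (p : State K m) (x : Misalignment m) :
    ℝ :=
  (1 / (W (stage p) : ℝ)) * ∑ l ∈ Finset.Icc 1 (W (stage p)),
    direct m (rate βd βc p) ((l : ℤ) + offset p) x

/-- `Q_I`: probability that a backoff cycle starting in state `p` has an interruption and ends
with misalignment `x`. -/
def probWithInterruption (W : Fin (K + 1) → ℕ) (βd βc : ℝ) (p : State K m) (x : Misalignment m) :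
    ℝ :=
  (1 / (W (stage p) : ℝ)) * ∑ l ∈ Finset.Icc 1 (W (stage p)),
    ∑ w ∈ Finset.Icc 1 (slots m (offset p) l),
      (1 - rate βd βc p) ^ (w - 1) * rate βd βc p *
        h m (betaS W m βd) x ((l : ℤ) + offset p - ((w : ℤ) + m)).toNat

/-- Transition matrix of the embedded chain. After a collision the stage becomes
`(s + 1) mod (K + 1)`, which is addition in `Fin (K + 1)`. -/
def transition (W : Fin (K + 1) → ℕ) (βd βc : ℝ) : Matrix (State K m) (State K m) ℝ
  | p, none => probNotInterrupted W βd βc p none + probWithInterruption W βd βc p none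
  | p, some (s', e) =>
      if s' = stage p + 1 then
        probNotInterrupted W βd βc p (some e) + probWithInterruption W βd βc p (some e)
      else 0

/-- `ψ` is a probability vector with `ψ = ψ Q`. -/
def IsStationary {S : Type*} [Fintype S] (Q : Matrix S S ℝ) (ψ : S → ℝ) : Prop :=
  ψ ∈ stdSimplex ℝ S ∧ Matrix.vecMul ψ Q = ψ

end Chain

/-- `(β_d, β_c)` solves the fixed point system: the embedded chain with the rates `β_d`, `β_c` and
`β_s = β_s(β_d)` has a unique stationary distribution `ψ`, and the rates computed from it are
`β_d` and `β_c` again. -/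
def IsFixedPoint (K m : ℕ) (W : Fin (K + 1) → ℕ) (βd βc : ℝ) : Prop :=
  ∃ ψ : State K m → ℝ,
    IsStationary (transition W βd βc) ψ ∧
    (∀ ψ' : State K m → ℝ, IsStationary (transition W βd βc) ψ' → ψ' = ψ) ∧
    βd = (∑ p, ψ p * probInterrupted m (W (stage p)) (offset p) (rate βd βc p)) /
      (∑ p, ψ p * meanResidual m (W (stage p)) (offset p) (rate βd βc p)) ∧
    βc = (∑ p ∈ Finset.univ.erase none,
        ψ p * (1 - probInterrupted m (W (stage p)) (offset p) (rate βd βc p))) /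
      (∑ p ∈ Finset.univ.erase none,
        ψ p * meanFirst m (W (stage p)) (offset p) (rate βd βc p))

end DCF

end

/-! The equations say that `(βd, βc)` is a fixed point of the map that sends the rates to the two
quotients at the stationary distribution `ψ`. Brouwer's theorem in the plane gives such a point once
this map is continuous and preserves a rectangle.

Let `A = 1 / W_K`. Both quotients lie in `[A, 1]` because of state-by-state inequalities. On an
interruption the residual backoff lies between `1` and `W`, so `P_I ≤ E_r ≤ W * P_I`. Writing `E_f`
as a sum of tail probabilities (`sum_pow_slots`) gives `1 - P_I ≤ E_f ≤ W * (1 - P_I)`. Averaging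
against `ψ` and using `W_s ≤ W_K` bounds the quotients, provided that the denominators are positive.

The edge `βc = 1` is the difficulty: the one-step route to `(0, 0_s)` used for uniqueness and the
positivity argument for the mean residual both need `βc < 1`. However, stage `K` always carries
mass, and `W_K ≥ 2` makes `1 - P_I < E_f` strict there, so the quotient for `βc` is below `1` at
every stationary distribution, even if `βc = 1`. The triples (rates, stationary distribution) form a
compact set, so the quotient has a maximum `c < 1` (`exists_rateAfterCollision_le`). No uniqueness
is needed for this. On `[A, 1] × [A, c]` the stationary distribution is unique, hence continuous
(`continuousOn_of_isStationary`), and `exists_fixedPoint_rectangle` applies. -/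

/-! ### Brouwer's theorem for a rectangle, by winding of the argument -/

/-- A continuous real function that stays in the set where `cos (· - φ)` is nonnegative stays in
one component of that set. -/
theorem abs_sub_le_pi_div_two_of_cos_nonneg {u : ℝ → ℝ} (hu : Continuous u) {φ s : ℝ}
    (hs : |u s - φ| ≤ Real.pi / 2) (hcos : ∀ t, 0 ≤ Real.cos (u t - φ)) (t : ℝ) :
    |u t - φ| ≤ Real.pi / 2 := by
  by_contra! h
  have hv : Continuous fun x => |u x - φ| := by fun_prop
  obtain ⟨y, hy1, hy2⟩ : ∃ y, Real.pi / 2 < y ∧ y < min (|u t - φ|) (Real.pi + Real.pi / 2) :=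
    exists_between (lt_min h (by linarith [Real.pi_pos]))
  obtain ⟨x, hx⟩ := mem_range_of_exists_le_of_exists_ge hv ⟨s, hs.trans hy1.le⟩
    ⟨t, (hy2.trans_le (min_le_left _ _)).le⟩
  have := Real.cos_neg_of_pi_div_two_lt_of_lt hy1 (hy2.trans_le (min_le_right _ _))
  rw [← hx, Real.cos_abs] at this
  exact absurd (hcos x) (not_le.2 this)

/-- A continuous map of a compact rectangle to itself, given by its coordinates, has a fixed
point. -/
theorem exists_fixedPoint_rectangle {a b c d : ℝ} (hab : a ≤ b) (hcd : c ≤ d) {f g : ℝ × ℝ → ℝ}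
    (hf : ContinuousOn f (Set.Icc a b ×ˢ Set.Icc c d))
    (hg : ContinuousOn g (Set.Icc a b ×ˢ Set.Icc c d))
    (hfm : Set.MapsTo f (Set.Icc a b ×ˢ Set.Icc c d) (Set.Icc a b))
    (hgm : Set.MapsTo g (Set.Icc a b ×ˢ Set.Icc c d) (Set.Icc c d)) :
    ∃ p ∈ Set.Icc a b ×ˢ Set.Icc c d, f p = p.1 ∧ g p = p.2 := by
  by_contra! hno
  -- Composing with the retraction `r` defines the displacement on the whole simply connected plane,
  -- where a nonvanishing map lifts through `exp`.
  let r : ℝ × ℝ → ℝ × ℝ := fun p => (max a (min b p.1), max c (min d p.2))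
  have hr : ∀ p, r p ∈ Set.Icc a b ×ˢ Set.Icc c d := fun p =>
    ⟨⟨le_max_left _ _, max_le hab (min_le_left _ _)⟩,
      ⟨le_max_left _ _, max_le hcd (min_le_left _ _)⟩⟩
  have hrc : Continuous r := by fun_prop
  let F : C(ℝ × ℝ, ℂ) :=
    ⟨fun p => (((r p).1 - f (r p) : ℝ) : ℂ) + (((r p).2 - g (r p) : ℝ) : ℂ) * Complex.I, by
      have h1 : Continuous fun p => f (r p) := hf.comp_continuous hrc hr
      have h2 : Continuous fun p => g (r p) := hg.comp_continuous hrc hr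
      exact (Complex.continuous_ofReal.comp (hrc.fst.sub h1)).add
        ((Complex.continuous_ofReal.comp (hrc.snd.sub h2)).mul continuous_const)⟩
  have Fre : ∀ p, (F p).re = (r p).1 - f (r p) := fun p => by simp [F]
  have Fim : ∀ p, (F p).im = (r p).2 - g (r p) := fun p => by simp [F]
  have hF : ∀ p, F p ∈ ({0}ᶜ : Set ℂ) := by
    intro p h0
    have h1 := congrArg Complex.re h0
    have h2 := congrArg Complex.im h0
    rw [Fre, Complex.zero_re] at h1
    rw [Fim, Complex.zero_im] at h2
    exact hno _ (hr p) (by linarith) (by linarith)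
  obtain ⟨G, ⟨hG0, hG⟩, -⟩ := Complex.isCoveringMapOn_exp.existsUnique_continuousMap_lifts F
    (a₀ := (b, d)) (e₀ := Complex.log (F (b, d))) (Complex.exp_log (hF _)) hF
  let θ : ℝ × ℝ → ℝ := fun p => (G p).im
  have hθ : Continuous θ := by fun_prop
  have hre : ∀ p, (r p).1 - f (r p) = Real.exp (G p).re * Real.cos (θ p) := fun p => by
    rw [← Fre, ← hG]; simp [Complex.exp_re, θ]
  have him : ∀ p, (r p).2 - g (r p) = Real.exp (G p).re * Real.sin (θ p) := fun p => by
    rw [← Fim, ← hG]; simp [Complex.exp_im, θ]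
  have right : ∀ t, 0 ≤ Real.cos (θ (b, t)) := fun t => by
    have h1 : (r (b, t)).1 = b := by simp [r, hab]
    have h2 := (hfm (hr (b, t))).2
    exact nonneg_of_mul_nonneg_right (by rw [← hre]; linarith) (Real.exp_pos _)
  have top : ∀ t, 0 ≤ Real.sin (θ (t, d)) := fun t => by
    have h1 : (r (t, d)).2 = d := by simp [r, hcd]
    have h2 := (hgm (hr (t, d))).2
    exact nonneg_of_mul_nonneg_right (by rw [← him]; linarith) (Real.exp_pos _)
  have left : ∀ t, Real.cos (θ (a, t)) ≤ 0 := fun t => by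
    have h1 : (r (a, t)).1 = a := by simp [r, hab]
    have h2 := (hfm (hr (a, t))).1
    have h3 := hre (a, t)
    by_contra! h
    nlinarith [mul_pos (Real.exp_pos (G (a, t)).re) h]
  have bot : ∀ t, Real.sin (θ (t, c)) ≤ 0 := fun t => by
    have h1 : (r (t, c)).2 = c := by simp [r, hcd]
    have h2 := (hgm (hr (t, c))).1
    have h3 := him (t, c)
    by_contra! h
    nlinarith [mul_pos (Real.exp_pos (G (t, c)).re) h]
  -- Follow the argument `θ` counterclockwise from the corner `(b, d)`. On each edge the sign of one
  -- coordinate keeps `θ` within `π / 2` of a centre: `0`, `π / 2`, `π`, `3π / 2` in turn. At a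
  -- corner two sign conditions hold, which places `θ` in the next range.
  have hpi := Real.pi_pos
  have c0 : |θ (b, d)| ≤ Real.pi / 2 := by
    have : θ (b, d) = Complex.arg (F (b, d)) := by simp [θ, hG0, Complex.log_im]
    rw [this, Complex.abs_arg_le_pi_div_two_iff, Fre, hre]
    exact mul_nonneg (Real.exp_pos _).le (right d)
  have R := abs_sub_le_pi_div_two_of_cos_nonneg (u := fun t => θ (b, t)) (φ := 0) (s := d)
    (by fun_prop) (by simpa using c0) (by simpa using right)
  have c1 : 0 ≤ θ (b, d) := by
    by_contra! h
    have := Real.sin_neg_of_neg_of_neg_pi_lt h (by linarith [(abs_le.1 c0).1])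
    linarith [top b]
  have T := abs_sub_le_pi_div_two_of_cos_nonneg (u := fun t => θ (t, d)) (φ := Real.pi / 2)
    (s := b) (by fun_prop) (abs_le.2 ⟨by linarith, by linarith [(abs_le.1 c0).2]⟩)
    (fun t => by simpa [Real.cos_sub_pi_div_two] using top t)
  have c2 : Real.pi / 2 ≤ θ (a, d) := by
    by_contra! h
    have := Real.cos_pos_of_mem_Ioo ⟨by linarith [(abs_le.1 (T a)).1], h⟩
    linarith [left d]
  have L := abs_sub_le_pi_div_two_of_cos_nonneg (u := fun t => θ (a, t)) (φ := Real.pi)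
    (s := d) (by fun_prop) (abs_le.2 ⟨by linarith, by linarith [(abs_le.1 (T a)).2]⟩)
    (fun t => by simpa [Real.cos_sub_pi] using left t)
  have c3 : Real.pi ≤ θ (a, c) := by
    by_contra! h
    have := Real.sin_pos_of_pos_of_lt_pi (by linarith [(abs_le.1 (L c)).1]) h
    linarith [bot a]
  have B := abs_sub_le_pi_div_two_of_cos_nonneg (u := fun t => θ (t, c))
    (φ := Real.pi + Real.pi / 2) (s := a) (by fun_prop)
    (abs_le.2 ⟨by linarith, by linarith [(abs_le.1 (L c)).2]⟩)
    (fun t => by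
      rw [← sub_sub, Real.cos_sub_pi_div_two, Real.sin_sub_pi]
      simpa using bot t)
  -- Back on the right edge, the bottom edge forces `θ (b, c) ≥ π` while the right edge forces `θ
  -- (b, c) ≤ π / 2`.
  linarith [(abs_le.1 (B b)).1, (abs_le.1 (R c)).2]

namespace DCF

noncomputable section

/-! ### Stationary distributions of finite stochastic matrices -/

section Stationary

variable {S : Type*} [Fintype S] {Q : Matrix S S ℝ}

/-- The triangle inequality gives `|φ| ≤ |φ| Q` entrywise. Both sides have the same total since the
rows sum to one, so equality holds in every entry. -/
theorem abs_vecMul_eq_of_vecMul_eq (hQ : ∀ p q, 0 ≤ Q p q) (hrow : ∀ p, ∑ q, Q p q = 1)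
    {φ : S → ℝ} (hφ : Matrix.vecMul φ Q = φ) : Matrix.vecMul |φ| Q = |φ| := by
  have hle : ∀ q ∈ Finset.univ, |φ| q ≤ Matrix.vecMul |φ| Q q := fun q _ => by
    calc |φ| q = |∑ p, φ p * Q p q| := by
          rw [Pi.abs_apply]; conv_lhs => rw [← hφ]
          rfl
      _ ≤ ∑ p, |φ p * Q p q| := Finset.abs_sum_le_sum_abs _ _
      _ = Matrix.vecMul |φ| Q q := by
          refine Finset.sum_congr rfl fun p _ => ?_
          rw [abs_mul, abs_of_nonneg (hQ p q)]; rfl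
  have hsum : ∑ q, |φ| q = ∑ q, Matrix.vecMul |φ| Q q := by
    simp only [Matrix.vecMul, dotProduct]
    rw [Finset.sum_comm]
    simp [← Finset.mul_sum, hrow]
  exact funext fun q => (((Finset.sum_eq_sum_iff_of_le hle).1 hsum) q (Finset.mem_univ q)).symm

/-- A stochastic matrix has a stationary distribution. -/
theorem exists_isStationary [Nonempty S] (hQ : ∀ p q, 0 ≤ Q p q) (hrow : ∀ p, ∑ q, Q p q = 1) :
    ∃ ψ, IsStationary Q ψ := by
  classical
  obtain ⟨φ, hφ0, hφ⟩ : ∃ φ ≠ 0, Matrix.vecMul φ (Q - 1) = 0 := by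
    -- `Q - 1` kills the all-ones column, so its determinant vanishes and it has a left null vector
    -- too.
    rw [Matrix.exists_vecMul_eq_zero_iff, ← Matrix.exists_mulVec_eq_zero_iff]
    refine ⟨1, one_ne_zero, ?_⟩
    ext p
    rw [Matrix.sub_mulVec, Matrix.one_mulVec]
    simp [Matrix.mulVec, dotProduct, hrow]
  rw [Matrix.vecMul_sub, Matrix.vecMul_one, sub_eq_zero] at hφ
  have habs := abs_vecMul_eq_of_vecMul_eq hQ hrow hφ
  have hpos : 0 < ∑ p, |φ| p := by
    refine (Finset.sum_nonneg fun p _ => abs_nonneg (φ p)).lt_of_ne fun h0 => hφ0 ?_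
    ext p
    exact abs_eq_zero.1 ((Finset.sum_eq_zero_iff_of_nonneg fun p _ => abs_nonneg (φ p)).1 h0.symm p
      (Finset.mem_univ p))
  refine ⟨(∑ p, |φ| p)⁻¹ • |φ|, ⟨fun p => ?_, ?_⟩, ?_⟩
  · exact mul_nonneg (inv_nonneg.2 hpos.le) (abs_nonneg (φ p))
  · simp only [Pi.smul_apply, smul_eq_mul, ← Finset.mul_sum]
    exact inv_mul_cancel₀ hpos.ne'
  · rw [Matrix.smul_vecMul, habs]

/-- The support of a nonnegative invariant vector is closed under the transitions. -/
theorem pos_of_vecMul_eq (hQ : ∀ p q, 0 ≤ Q p q) {ψ : S → ℝ} (hψ0 : ∀ p, 0 ≤ ψ p)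
    (hψ : Matrix.vecMul ψ Q = ψ) {p q : S} (hp : 0 < ψ p) (hpq : 0 < Q p q) : 0 < ψ q := by
  rw [← hψ]
  exact Finset.sum_pos' (fun i _ => mul_nonneg (hψ0 i) (hQ i q))
    ⟨p, Finset.mem_univ p, mul_pos hp hpq⟩

theorem IsStationary.pos_of_pos (hQ : ∀ p q, 0 ≤ Q p q) {ψ : S → ℝ} (hψ : IsStationary Q ψ)
    {p q : S} (hp : 0 < ψ p) (hpq : 0 < Q p q) : 0 < ψ q :=
  pos_of_vecMul_eq hQ hψ.1.1 hψ.2 hp hpq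

theorem IsStationary.exists_pos {ψ : S → ℝ} (hψ : IsStationary Q ψ) : ∃ p, 0 < ψ p := by
  by_contra! h
  have : ∑ p, ψ p ≤ 0 := Finset.sum_nonpos fun p _ => h p
  linarith [hψ.1.2]

/-- A stochastic matrix with a state that every other state leads to in one step has at most one
stationary distribution. -/
theorem IsStationary.eq_of_forall_pos (hQ : ∀ p q, 0 ≤ Q p q) (hrow : ∀ p, ∑ q, Q p q = 1) {o : S}
    (ho : ∀ p ≠ o, 0 < Q p o) {ψ ψ' : S → ℝ} (hψ : IsStationary Q ψ) (hψ' : IsStationary Q ψ') :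
    ψ' = ψ := by
  have key : ∀ φ : S → ℝ, Matrix.vecMul φ Q = φ → φ o = 0 → φ = 0 := by
    intro φ hφ hφo
    ext p
    by_contra hp
    have hpo : p ≠ o := by rintro rfl; exact hp hφo
    have := pos_of_vecMul_eq hQ (fun i => abs_nonneg (φ i))
      (abs_vecMul_eq_of_vecMul_eq hQ hrow hφ) (abs_pos.2 hp) (ho p hpo)
    simp [hφo] at this
  -- This combination is invariant and vanishes at `o`, so it is zero and the two distributions are
  -- proportional.
  have h := key (ψ' o • ψ - ψ o • ψ') (by
    rw [Matrix.sub_vecMul, Matrix.smul_vecMul, Matrix.smul_vecMul, hψ.2, hψ'.2]) (by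
    simp [mul_comm])
  have hpo : ψ o ≠ 0 := fun h0 => by
    obtain ⟨p, hp⟩ := hψ.exists_pos
    simp [key ψ hψ.2 h0] at hp
  have hoo : ψ' o = ψ o := by
    have := congrArg (fun v : S → ℝ => ∑ p, v p) h
    simp only [Pi.sub_apply, Pi.smul_apply, smul_eq_mul, Finset.sum_sub_distrib, ← Finset.mul_sum,
      hψ.1.2, hψ'.1.2, Pi.zero_apply, Finset.sum_const_zero] at this
    linarith
  ext p
  have := congrFun h p
  simp only [Pi.sub_apply, Pi.smul_apply, smul_eq_mul, Pi.zero_apply, hoo] at this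
  exact (mul_left_cancel₀ hpo (sub_eq_zero.1 this)).symm

/-- Unique stationary distributions depend continuously on the transition matrix. -/
theorem continuousOn_of_isStationary {X : Type*} [TopologicalSpace X] {B : Set X}
    {Q : X → Matrix S S ℝ} (hQ : ∀ p q, ContinuousOn (fun x => Q x p q) B) {ψ : X → S → ℝ}
    (hψ : ∀ x ∈ B, IsStationary (Q x) (ψ x))
    (huniq : ∀ x ∈ B, ∀ φ, IsStationary (Q x) φ → φ = ψ x) : ContinuousOn ψ B := by
  intro x hx
  -- By compactness of the simplex it suffices that every cluster point of `ψ` at `x` is stationary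
  -- for `Q x`.
  refine (isCompact_stdSimplex ℝ S).tendsto_nhds_of_unique_mapClusterPt
    (eventually_mem_nhdsWithin.mono fun y hy => (hψ y hy).1) fun φ hφ hcl => huniq x hx φ ⟨hφ, ?_⟩
  obtain ⟨u, hu, hlim⟩ := mapClusterPt_iff_ultrafilter.1 hcl
  have huB : ∀ᶠ y in (u : Filter X), y ∈ B := hu eventually_mem_nhdsWithin
  have hQl : ∀ p q, Filter.Tendsto (fun y => Q y p q) u (nhds (Q x p q)) :=
    fun p q => (hQ p q x hx).mono_left hu
  ext q
  have h1 : Filter.Tendsto (fun y => Matrix.vecMul (ψ y) (Q y) q) u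
      (nhds (Matrix.vecMul φ (Q x) q)) :=
    tendsto_finsetSum _ fun p _ => ((tendsto_pi_nhds.1 hlim) p).mul (hQl p q)
  refine tendsto_nhds_unique h1 (((tendsto_pi_nhds.1 hlim) q).congr' ?_)
  filter_upwards [huB] with y hy
  rw [(hψ y hy).2]

end Stationary

/-! ### Outcome probabilities and their totals -/

theorem sum_Icc_int_sub {a b : ℤ} (hab : a ≤ b + 1) (G : ℤ → ℝ) :
    ∑ e ∈ Finset.Icc a b, (G (e - 1) - G e) = G (a - 1) - G b := by
  obtain ⟨n, hn⟩ := Int.eq_ofNat_of_zero_le (sub_nonneg.2 hab)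
  induction n generalizing b with
  | zero =>
    have : a = b + 1 := by simp at hn; omega
    subst this
    simp
  | succ n ih =>
    have hb : a ≤ b := by push_cast at hn; omega
    rw [← Finset.insert_Icc_sub_one_right_eq_Icc hb, Finset.sum_insert (by simp),
      ih (by omega) (by push_cast at hn; omega)]
    ring

theorem sum_geom_mul (β : ℝ) (n : ℕ) :
    ∑ w ∈ Finset.range n, (1 - β) ^ w * β = 1 - (1 - β) ^ n := by
  induction n with
  | zero => simp
  | succ n ih => rw [Finset.sum_range_succ, ih]; ring

theorem sum_Icc_geom_mul (β : ℝ) (n : ℕ) :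
    ∑ w ∈ Finset.Icc 1 n, (1 - β) ^ (w - 1) * β = 1 - (1 - β) ^ n := by
  rw [← sum_geom_mul, Finset.range_eq_Ico, Finset.sum_Ico_eq_sum_range, ← Finset.Ico_succ_right_eq_Icc,
    Finset.sum_Ico_eq_sum_range]
  simp

section Outcomes

variable {m : ℕ} {β : ℝ}

theorem direct_nonneg (h0 : 0 ≤ β) (h1 : β ≤ 1) (L : ℤ) (x : Misalignment m) :
    0 ≤ direct m β L x := by
  have := sub_nonneg.2 h1
  cases x with
  | none => exact pow_nonneg this _
  | some e =>
    rw [direct]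
    split_ifs <;> positivity

/-- A collision term is a difference of consecutive survival probabilities, with `toNat` absorbing
the indicator. The sum telescopes and, with the success term, leaves the probability of no
interruption. -/
theorem sum_direct (L : ℤ) : ∑ x, direct m β L x = (1 - β) ^ (L - m - 1).toNat := by
  let G : ℤ → ℝ := fun k => (1 - β) ^ (L + k).toNat
  have hG : ∀ e : ℤ, (if 1 ≤ L + e then (1 - β) ^ (L + e - 1).toNat * β else 0) =
      G (e - 1) - G e := by
    intro e
    split_ifs with h
    · obtain ⟨n, hn⟩ := Int.eq_ofNat_of_zero_le (show 0 ≤ L + e - 1 by omega)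
      have h1 : (L + (e - 1)).toNat = n := by omega
      have h2 : (L + e).toNat = n + 1 := by omega
      have h3 : (L + e - 1).toNat = n := by omega
      simp only [G, h1, h2, h3]
      ring
    · have h1 : (L + (e - 1)).toNat = 0 := by omega
      have h2 : (L + e).toNat = 0 := by omega
      simp [G, h1, h2]
  rw [Fintype.sum_option]
  simp only [direct, hG]
  rw [Finset.sum_coe_sort (Finset.Icc (-(m : ℤ)) m) fun e => G (e - 1) - G e,
    sum_Icc_int_sub (by omega)]
  have : L + (-(m : ℤ) - 1) = L - m - 1 := by ring
  simp [G, this]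

theorem h_nonneg (h0 : 0 ≤ β) (h1 : β ≤ 1) (x : Misalignment m) (b : ℕ) : 0 ≤ h m β x b := by
  have hb := sub_nonneg.2 h1
  induction b using Nat.strong_induction_on with
  | _ b ih =>
    rw [h]
    refine add_nonneg (direct_nonneg h0 h1 _ _) (Finset.sum_nonneg fun w _ => ?_)
    have := ih (b - ((w : ℕ) + 1 + m)) (by have := w.isLt; omega)
    positivity

theorem sum_h {b : ℕ} (hb : 1 ≤ b) : ∑ x, h m β x b = 1 := by
  induction b using Nat.strong_induction_on with
  | _ b ih =>
    simp_rw [fun x => h.eq_1 m β x b]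
    rw [Finset.sum_add_distrib, sum_direct, Finset.sum_comm]
    simp_rw [← Finset.mul_sum]
    have : ∀ w : Fin (b - m - 1), ∑ x, h m β x (b - ((w : ℕ) + 1 + m)) = 1 := fun w =>
      ih _ (by have := w.isLt; omega) (by have := w.isLt; omega)
    simp only [this, mul_one]
    rw [Fin.sum_univ_eq_sum_range (fun w => (1 - β) ^ w * β), sum_geom_mul]
    have : ((b : ℤ) - m - 1).toNat = b - m - 1 := by omega
    rw [this]
    ring

theorem continuous_direct (L : ℤ) (x : Misalignment m) : Continuous fun β => direct m β L x := by
  cases x with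
  | none => simp only [direct]; fun_prop
  | some e =>
    simp only [direct]
    split_ifs <;> fun_prop

theorem continuous_h (x : Misalignment m) (b : ℕ) : Continuous fun β => h m β x b := by
  induction b using Nat.strong_induction_on with
  | _ b ih =>
    simp_rw [fun β => h.eq_1 m β x b]
    refine (continuous_direct _ _).add (continuous_finsetSum _ fun w _ => ?_)
    exact (by fun_prop : Continuous fun β : ℝ => (1 - β) ^ (w : ℕ) * β).mul
      (ih _ (by have := w.isLt; omega))

end Outcomes

/-! ### Bounds for a single backoff cycle -/

section Cycle

variable {m W : ℕ} {d : ℤ} {β : ℝ}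

theorem one_sub_probInterrupted (hW : 1 ≤ W) :
    1 - probInterrupted m W d β =
      (1 / (W : ℝ)) * ∑ l ∈ Finset.Icc 1 W, (1 - β) ^ slots m d l := by
  have : (W : ℝ) ≠ 0 := by positivity
  rw [probInterrupted, Finset.sum_sub_distrib]
  simp
  field_simp
  ring

/-- The backoff counted until an interruption or the completion of a backoff `l`, as the sum of
the probabilities that the slots `1, …, l` are reached. -/
theorem sum_pow_slots (l : ℕ) (hd : d ≤ m) :
    (1 - β) ^ slots m d l * (l : ℝ) + ∑ w ∈ Finset.Icc 1 (slots m d l),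
      (1 - β) ^ (w - 1) * β * ((w : ℝ) + (m : ℝ) - (d : ℝ)) =
    ∑ k ∈ Finset.Icc 1 l, (1 - β) ^ slots m d k := by
  induction l with
  | zero =>
    have : slots m d 0 = 0 := by simp only [slots]; omega
    simp [this]
  | succ l ih =>
    rw [Finset.sum_Icc_succ_top (by omega), ← ih]
    by_cases hs : slots m d (l + 1) = 0
    · have h0 : slots m d l = 0 := by simp only [slots] at hs ⊢; omega
      simp [hs, h0]
    · have h0 : slots m d (l + 1) = slots m d l + 1 := by simp only [slots] at hs ⊢; omega
      have h1 : (l : ℤ) = slots m d l + 1 + m - d := by simp only [slots] at hs ⊢; omega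
      have h2 : (l : ℝ) = slots m d l + 1 + m - d := by exact_mod_cast h1
      rw [h0, Finset.sum_Icc_succ_top (by omega)]
      push_cast
      have h3 : (slots m d l : ℝ) + 1 + m - d = l := h2.symm
      rw [h3]
      ring

theorem meanFirst_eq (hd : d ≤ m) : meanFirst m W d β =
    (1 / (W : ℝ)) * ∑ l ∈ Finset.Icc 1 W, ∑ k ∈ Finset.Icc 1 l, (1 - β) ^ slots m d k := by
  simp only [meanFirst, sum_pow_slots _ hd]

theorem slots_one (hd : d ≤ m) : slots m d 1 = 0 := by simp only [slots]; omega

theorem one_div_le_one_sub_probInterrupted (hW : 1 ≤ W) (hd : d ≤ m) (h1 : β ≤ 1) :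
    1 / (W : ℝ) ≤ 1 - probInterrupted m W d β := by
  rw [one_sub_probInterrupted hW]
  refine le_mul_of_one_le_right (by positivity) ?_
  calc (1 : ℝ) = (1 - β) ^ slots m d 1 := by rw [slots_one hd, pow_zero]
    _ ≤ _ := Finset.single_le_sum (f := fun l => (1 - β) ^ slots m d l)
      (fun l _ => pow_nonneg (sub_nonneg.2 h1) _) (by simpa using hW)

/-- Enlarge the inner range `1, …, l` of the tail sum to `1, …, W`; for the lower bound below, keep
only `k = l`. -/
theorem meanFirst_le (hW : 1 ≤ W) (hd : d ≤ m) (h1 : β ≤ 1) :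
    meanFirst m W d β ≤ W * (1 - probInterrupted m W d β) := by
  rw [one_sub_probInterrupted hW, meanFirst_eq hd, mul_left_comm]
  refine mul_le_mul_of_nonneg_left ?_ (by positivity)
  calc _ ≤ ∑ l ∈ Finset.Icc 1 W, ∑ k ∈ Finset.Icc 1 W, (1 - β) ^ slots m d k :=
        Finset.sum_le_sum fun l hl => Finset.sum_le_sum_of_subset_of_nonneg
          (Finset.Icc_subset_Icc_right (Finset.mem_Icc.1 hl).2)
          fun k _ _ => pow_nonneg (sub_nonneg.2 h1) _
    _ = _ := by simp

theorem le_meanFirst (hW : 1 ≤ W) (hd : d ≤ m) (h1 : β ≤ 1) :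
    1 - probInterrupted m W d β ≤ meanFirst m W d β := by
  rw [one_sub_probInterrupted hW, meanFirst_eq hd]
  refine mul_le_mul_of_nonneg_left (Finset.sum_le_sum fun l hl => ?_) (by positivity)
  exact Finset.single_le_sum (f := fun l => (1 - β) ^ slots m d l)
    (fun l _ => pow_nonneg (sub_nonneg.2 h1) _) (by simpa using (Finset.mem_Icc.1 hl).1)

/-- For `l = 2` the tail sum has the extra term `k = 1`, which equals `1` for every `β`, including
`β = 1`. -/
theorem lt_meanFirst (hW : 2 ≤ W) (hd : d ≤ m) (h1 : β ≤ 1) :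
    1 - probInterrupted m W d β < meanFirst m W d β := by
  have hq := sub_nonneg.2 h1
  rw [one_sub_probInterrupted (by omega), meanFirst_eq hd]
  refine mul_lt_mul_of_pos_left (Finset.sum_lt_sum (fun l hl => ?_) ⟨2, by simpa using hW, ?_⟩)
    (by positivity)
  · exact Finset.single_le_sum (f := fun l => (1 - β) ^ slots m d l)
      (fun l _ => pow_nonneg (sub_nonneg.2 h1) _) (by simpa using (Finset.mem_Icc.1 hl).1)
  · rw [Finset.sum_Icc_succ_top (by omega)]
    simp [slots_one hd]

theorem probInterrupted_eq : probInterrupted m W d β =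
    (1 / (W : ℝ)) * ∑ l ∈ Finset.Icc 1 W, ∑ w ∈ Finset.Icc 1 (slots m d l),
      (1 - β) ^ (w - 1) * β := by
  simp only [probInterrupted, sum_Icc_geom_mul]

theorem probInterrupted_nonneg (h0 : 0 ≤ β) (h1 : β ≤ 1) : 0 ≤ probInterrupted m W d β := by
  have := sub_nonneg.2 h1
  rw [probInterrupted_eq]
  positivity

/-- With a window of only `2`, the offset `m` is the one at which an interruption is possible: `l =
2` leaves exactly one slot for it. -/
theorem probInterrupted_pos (hW : 2 ≤ W) (h0 : 0 < β) (h1 : β ≤ 1) :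
    0 < probInterrupted m W m β := by
  refine mul_pos (by positivity) (Finset.sum_pos' (fun l _ => ?_) ⟨2, by simpa using hW, ?_⟩)
  · exact sub_nonneg.2 (pow_le_one₀ (sub_nonneg.2 h1) (by linarith))
  · have : slots m m 2 = 1 := by simp only [slots]; omega
    simpa [this] using h0

theorem le_meanResidual (h0 : 0 ≤ β) (h1 : β ≤ 1) :
    probInterrupted m W d β ≤ meanResidual m W d β := by
  have hq := sub_nonneg.2 h1
  rw [probInterrupted_eq, meanResidual]
  refine mul_le_mul_of_nonneg_left ?_ (by positivity)
  refine Finset.sum_le_sum fun l _ => Finset.sum_le_sum fun w hw => ?_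
  refine le_mul_of_one_le_right (mul_nonneg (pow_nonneg hq _) h0) ?_
  have : (1 : ℤ) ≤ l + d - (w + m) := by
    have := Finset.mem_Icc.1 hw
    simp only [slots] at this
    omega
  exact_mod_cast this

theorem meanResidual_le (hd : d ≤ m) (h0 : 0 ≤ β) (h1 : β ≤ 1) :
    meanResidual m W d β ≤ W * probInterrupted m W d β := by
  have hq := sub_nonneg.2 h1
  rw [probInterrupted_eq, meanResidual, mul_left_comm]
  refine mul_le_mul_of_nonneg_left ?_ (by positivity)
  rw [Finset.mul_sum]
  refine Finset.sum_le_sum fun l hl => ?_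
  rw [Finset.mul_sum]
  refine Finset.sum_le_sum fun w hw => ?_
  rw [mul_comm (W : ℝ)]
  refine mul_le_mul_of_nonneg_left ?_ (by positivity)
  have : (l : ℤ) + d - (w + m) ≤ W := by
    have := Finset.mem_Icc.1 hl
    omega
  exact_mod_cast this

theorem continuous_probInterrupted : Continuous (probInterrupted m W d) := by
  unfold probInterrupted; fun_prop

theorem continuous_meanResidual : Continuous (meanResidual m W d) := by
  unfold meanResidual; fun_prop

theorem continuous_meanFirst : Continuous (meanFirst m W d) := by
  unfold meanFirst; fun_prop

end Cycle

/-! ### The embedded chain: stochasticity, continuity, reachable states -/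

variable {K m : ℕ} {W : Fin (K + 1) → ℕ} {βd βc : ℝ}

theorem offset_le (p : State K m) : offset p ≤ m := by
  rcases p with _ | ⟨s, d⟩
  · simp [offset]
  · exact (Finset.mem_Icc.1 d.2).2

theorem neg_le_offset (p : State K m) : -(m : ℤ) ≤ offset p := by
  rcases p with _ | ⟨s, d⟩
  · simp [offset]
  · exact (Finset.mem_Icc.1 d.2).1

theorem rate_mem {s : Set ℝ} (hd : βd ∈ s) (hc : βc ∈ s) (p : State K m) : rate βd βc p ∈ s := by
  cases p <;> assumption

theorem betaS_mem (hW : 1 ≤ W 0) (h1 : βd ≤ 1) : betaS W m βd ∈ Set.Icc (0 : ℝ) 1 := by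
  have h2 := one_div_le_one_sub_probInterrupted hW (d := 0) (m := m) (by simp) h1
  have h3 := le_meanFirst hW (d := 0) (m := m) (by simp) h1
  have h4 : (0 : ℝ) < 1 / W 0 := by positivity
  exact ⟨div_nonneg (by linarith) (by linarith), div_le_one_of_le₀ h3 (by linarith)⟩

theorem continuousOn_betaS (hW : 1 ≤ W 0) :
    ContinuousOn (betaS W m) (Set.Iic 1) := by
  refine ContinuousOn.div (continuous_const.sub continuous_probInterrupted).continuousOn
    continuous_meanFirst.continuousOn fun β h1 => ?_
  have h2 := one_div_le_one_sub_probInterrupted hW (d := 0) (m := m) (by simp) h1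
  have h3 := le_meanFirst hW (d := 0) (m := m) (by simp) h1
  have h4 : (0 : ℝ) < 1 / W 0 := by positivity
  linarith

/-- Probability that a backoff cycle starting in state `p` ends with misalignment `x`. -/
def outcomeProb (W : Fin (K + 1) → ℕ) (βd βc : ℝ) (p : State K m) (x : Misalignment m) : ℝ :=
  probNotInterrupted W βd βc p x + probWithInterruption W βd βc p x

theorem sum_outcomeProb (hW : ∀ s, 1 ≤ W s) (p : State K m) :
    ∑ x, outcomeProb W βd βc p x = 1 := by
  simp only [outcomeProb, probNotInterrupted, probWithInterruption, ← mul_add,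
    ← Finset.sum_add_distrib, ← Finset.mul_sum]
  rw [Finset.sum_comm]
  have key : ∀ l : ℕ, ∑ x, (direct m (rate βd βc p) ((l : ℤ) + offset p) x +
      ∑ w ∈ Finset.Icc 1 (slots m (offset p) l),
      (1 - rate βd βc p) ^ (w - 1) * rate βd βc p *
        h m (betaS W m βd) x ((l : ℤ) + offset p - ((w : ℤ) + m)).toNat) = 1 := by
    intro l
    rw [Finset.sum_add_distrib, sum_direct, Finset.sum_comm]
    have : ∀ w ∈ Finset.Icc 1 (slots m (offset p) l), ∑ x, (1 - rate βd βc p) ^ (w - 1) *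
        rate βd βc p * h m (betaS W m βd) x ((l : ℤ) + offset p - ((w : ℤ) + m)).toNat =
        (1 - rate βd βc p) ^ (w - 1) * rate βd βc p := by
      intro w hw
      rw [← Finset.mul_sum, sum_h, mul_one]
      have := Finset.mem_Icc.1 hw
      simp only [slots] at this
      omega
    rw [Finset.sum_congr rfl this, sum_Icc_geom_mul]
    simp [slots]
  simp only [key]
  have : (W (stage p) : ℝ) ≠ 0 := by have := hW (stage p); positivity
  simp [this]

theorem direct_le_outcomeProb (hW : ∀ s, 1 ≤ W s)
    (hd : βd ∈ Set.Icc (0 : ℝ) 1) (hc : βc ∈ Set.Icc (0 : ℝ) 1)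
    (p : State K m) (x : Misalignment m) {l : ℕ}
    (hl : l ∈ Finset.Icc 1 (W (stage p))) :
    1 / (W (stage p) : ℝ) * direct m (rate βd βc p) ((l : ℤ) + offset p) x ≤
      outcomeProb W βd βc p x := by
  have hr := rate_mem hd hc p
  have hs := betaS_mem (m := m) (hW 0) hd.2
  have hq := sub_nonneg.2 hr.2
  have hr0 := hr.1
  have h1 : 0 ≤ probWithInterruption W βd βc p x :=
    mul_nonneg (by positivity) (Finset.sum_nonneg fun l _ => Finset.sum_nonneg fun w _ =>
      mul_nonneg (by positivity) (h_nonneg hs.1 hs.2 _ _))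
  have h2 : 1 / (W (stage p) : ℝ) * direct m (rate βd βc p) ((l : ℤ) + offset p) x ≤
      probNotInterrupted W βd βc p x :=
    mul_le_mul_of_nonneg_left (Finset.single_le_sum
      (f := fun l : ℕ => direct m (rate βd βc p) ((l : ℤ) + offset p) x)
      (fun l _ => direct_nonneg hr.1 hr.2 _ _) hl) (by positivity)
  exact le_add_of_le_of_nonneg h2 h1

/-- All terms are nonnegative, so the backoff `l = 1`, available in every window, already suffices.
-/
theorem outcomeProb_pos_of_direct (hW : ∀ s, 1 ≤ W s)
    (hd : βd ∈ Set.Icc (0 : ℝ) 1) (hc : βc ∈ Set.Icc (0 : ℝ) 1)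
    (p : State K m) (x : Misalignment m)
    (h : 0 < direct m (rate βd βc p) (1 + offset p) x) : 0 < outcomeProb W βd βc p x := by
  have := hW (stage p)
  refine lt_of_lt_of_le (mul_pos (by positivity) ?_)
    (direct_le_outcomeProb hW hd hc p x (l := 1) (by simpa using this))
  simpa using h

theorem outcomeProb_nonneg (hW : ∀ s, 1 ≤ W s)
    (hd : βd ∈ Set.Icc (0 : ℝ) 1) (hc : βc ∈ Set.Icc (0 : ℝ) 1)
    (p : State K m) (x : Misalignment m) :
    0 ≤ outcomeProb W βd βc p x := by
  have hr := rate_mem hd hc p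
  exact le_trans (mul_nonneg (by positivity) (direct_nonneg hr.1 hr.2 _ _))
    (direct_le_outcomeProb hW hd hc p x (l := 1) (by simpa using hW (stage p)))

theorem transition_nonneg (hW : ∀ s, 1 ≤ W s)
    (hd : βd ∈ Set.Icc (0 : ℝ) 1) (hc : βc ∈ Set.Icc (0 : ℝ) 1)
    (p q : State K m) : 0 ≤ transition W βd βc p q := by
  rcases q with _ | ⟨s, e⟩
  · exact outcomeProb_nonneg hW hd hc p none
  · rw [transition]
    split_ifs
    · exact outcomeProb_nonneg hW hd hc p (some e)
    · exact le_rfl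

theorem transition_none_pos (hW : ∀ s, 1 ≤ W s)
    (hd : βd ∈ Set.Icc (0 : ℝ) 1) (hc : βc ∈ Set.Icc (0 : ℝ) 1)
    (h : βc < 1) {p : State K m} (hp : p ≠ none) :
    0 < transition W βd βc p none := by
  refine outcomeProb_pos_of_direct hW hd hc p none ?_
  obtain ⟨q, rfl⟩ := Option.ne_none_iff_exists'.1 hp
  exact pow_pos (sub_pos.2 h) _

theorem transition_collision_pos (hW : ∀ s, 1 ≤ W s)
    (hd : βd ∈ Set.Icc (0 : ℝ) 1) (hc : βc ∈ Set.Icc (0 : ℝ) 1)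
    (hd0 : 0 < βd) (hc0 : 0 < βc) (p : State K m) :
    ∃ e, 0 < transition W βd βc p (some (stage p + 1, e)) := by
  have h1 := offset_le p
  have h2 := neg_le_offset p
  -- With `l = 1` and the other node attempting at `w = 1`, the new misalignment is `1 - (1 + d) =
  -- -d`; this has weight `β` even if `β = 1`.
  refine ⟨⟨-offset p, Finset.mem_Icc.2 ⟨by omega, by omega⟩⟩, ?_⟩
  rw [transition, if_pos rfl]
  refine outcomeProb_pos_of_direct hW hd hc p (some _) ?_
  have : 0 < rate βd βc p := rate_mem (s := Set.Ioi 0) hd0 hc0 p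
  simpa [direct] using this

theorem transition_last_pos (hW : ∀ s, 1 ≤ W s)
    (hd : βd ∈ Set.Icc (0 : ℝ) 1) (hc : βc ∈ Set.Icc (0 : ℝ) 1)
    (hc0 : 0 < βc) (h : βc < 1) {p : State K m} (hp : p ≠ none) :
    0 < transition W βd βc p
      (some (stage p + 1, ⟨(m : ℤ), Finset.mem_Icc.2 ⟨by omega, le_rfl⟩⟩)) := by
  have h2 := neg_le_offset p
  rw [transition, if_pos rfl]
  refine outcomeProb_pos_of_direct hW hd hc p (some _) ?_
  obtain ⟨q, rfl⟩ := Option.ne_none_iff_exists'.1 hp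
  rw [direct, if_pos (by dsimp only; omega)]
  exact mul_pos (pow_pos (sub_pos.2 h) _) hc0

theorem sum_transition (hW : ∀ s, 1 ≤ W s) (p : State K m) :
    ∑ q, transition W βd βc p q = 1 := by
  rw [← sum_outcomeProb (βd := βd) (βc := βc) hW p, Fintype.sum_option, Fintype.sum_option,
    Fintype.sum_prod_type, Finset.sum_comm]
  simp [transition, outcomeProb]

theorem continuous_rate (p : State K m) : Continuous fun x : ℝ × ℝ => rate x.1 x.2 p := by
  cases p
  · exact continuous_fst
  · exact continuous_snd

theorem continuousOn_outcomeProb (hW : 1 ≤ W 0) (p : State K m) (x : Misalignment m) :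
    ContinuousOn (fun b : ℝ × ℝ => outcomeProb W b.1 b.2 p x) (Set.Iic 1 ×ˢ Set.univ) := by
  have hr := continuous_rate p
  have hs : ContinuousOn (fun b : ℝ × ℝ => betaS W m b.1) (Set.Iic 1 ×ˢ Set.univ) :=
    (continuousOn_betaS hW).comp continuousOn_fst fun b hb => hb.1
  refine ContinuousOn.add (Continuous.continuousOn ?_) ?_
  · exact continuous_const.mul
      (continuous_finsetSum _ fun l _ => (continuous_direct _ _).comp hr)
  · refine continuousOn_const.mul
      (continuousOn_finsetSum _ fun l _ => continuousOn_finsetSum _ fun w _ => ?_)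
    refine ContinuousOn.mul (Continuous.continuousOn (by fun_prop)) ?_
    exact (continuous_h x _).comp_continuousOn hs

theorem continuousOn_transition (hW : 1 ≤ W 0) (p q : State K m) :
    ContinuousOn (fun b : ℝ × ℝ => transition W b.1 b.2 p q) (Set.Iic 1 ×ˢ Set.univ) := by
  rcases q with _ | ⟨s, e⟩
  · exact continuousOn_outcomeProb hW p none
  · simp only [transition]
    split_ifs
    · exact continuousOn_outcomeProb hW p (some e)
    · exact continuousOn_const

open Fin.NatCast in
theorem IsStationary.exists_stage_pos (hW : ∀ s, 1 ≤ W s) (hd : βd ∈ Set.Ioc (0 : ℝ) 1)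
    (hc : βc ∈ Set.Ioc (0 : ℝ) 1) {ψ : State K m → ℝ} (hψ : IsStationary (transition W βd βc) ψ)
    (s : Fin (K + 1)) : ∃ d, 0 < ψ (some (s, d)) := by
  have hd' := Set.Ioc_subset_Icc_self hd
  have hc' := Set.Ioc_subset_Icc_self hc
  have step : ∀ p, 0 < ψ p → ∃ e, 0 < ψ (some (stage p + 1, e)) := fun p hp => by
    obtain ⟨e, he⟩ := transition_collision_pos hW hd' hc' hd.1 hc.1 p
    exact ⟨e, hψ.pos_of_pos (transition_nonneg hW hd' hc') hp he⟩
  obtain ⟨p, hp⟩ := hψ.exists_pos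
  have iter : ∀ n : ℕ, ∃ e, 0 < ψ (some (stage p + 1 + (n : Fin (K + 1)), e)) := by
    intro n
    induction n with
    | zero => simpa using step p hp
    | succ n ih =>
      obtain ⟨e, he⟩ := ih
      simpa [stage, add_assoc] using step _ he
  -- Collisions advance the stage cyclically, so this many steps reach stage `s`.
  have := iter (s - (stage p + 1)).val
  rwa [Fin.cast_val_eq_self, add_sub_cancel] at this

theorem IsStationary.last_offset_pos (hW : ∀ s, 1 ≤ W s) (hd : βd ∈ Set.Ioc (0 : ℝ) 1)
    (hc : βc ∈ Set.Ioo (0 : ℝ) 1) {ψ : State K m → ℝ} (hψ : IsStationary (transition W βd βc) ψ)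
    (s : Fin (K + 1)) :
    0 < ψ (some (s, ⟨(m : ℤ), Finset.mem_Icc.2 ⟨by omega, le_rfl⟩⟩)) := by
  have hd' := Set.Ioc_subset_Icc_self hd
  have hc' := Set.Ioo_subset_Icc_self hc
  obtain ⟨d, h⟩ := hψ.exists_stage_pos hW hd (Set.Ioo_subset_Ioc_self hc) (s - 1)
  have := hψ.pos_of_pos (transition_nonneg hW hd' hc') h
    (transition_last_pos hW hd' hc' hc.1 hc.2 (p := some (s - 1, d)) (by simp))
  simpa [stage] using this

/-! ### Averages over the chain and bounds for the two quotients -/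

/-- Mean of a characteristic `F` of the backoff cycle, restricted to cycles that start in `s`, as a
function of the rates and of the distribution of the initial state. -/
def cycleSum (W : Fin (K + 1) → ℕ) (F : ℕ → ℤ → ℝ → ℝ) (s : Finset (State K m))
    (y : (ℝ × ℝ) × (State K m → ℝ)) : ℝ :=
  ∑ p ∈ s, y.2 p * F (W (stage p)) (offset p) (rate y.1.1 y.1.2 p)

theorem continuous_cycleSum {F : ℕ → ℤ → ℝ → ℝ} (hF : ∀ w d, Continuous (F w d))
    (s : Finset (State K m)) : Continuous (cycleSum W F s) :=
  continuous_finsetSum _ fun p _ => ((continuous_apply p).comp continuous_snd).mul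
    ((hF _ _).comp ((continuous_rate p).comp continuous_fst))

/-- The right-hand side of the equation for `β_d`. -/
def rateAfterSuccess (W : Fin (K + 1) → ℕ) (y : (ℝ × ℝ) × (State K m → ℝ)) : ℝ :=
  cycleSum W (probInterrupted m) Finset.univ y / cycleSum W (meanResidual m) Finset.univ y

/-- The right-hand side of the equation for `β_c`. -/
def rateAfterCollision (W : Fin (K + 1) → ℕ) (y : (ℝ × ℝ) × (State K m → ℝ)) : ℝ :=
  cycleSum W (fun w d β => 1 - probInterrupted m w d β) (Finset.univ.erase none) y /
    cycleSum W (meanFirst m) (Finset.univ.erase none) y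

theorem div_mem_Icc_one_div {a b w : ℝ} (hw : 0 < w) (hab : a ≤ b) (hba : b ≤ w * a)
    (hb : 0 < b) : a / b ∈ Set.Icc (1 / w) 1 :=
  ⟨(div_le_div_iff₀ hw hb).2 (by linarith), div_le_one_of_le₀ hab hb.le⟩

theorem cycleSum_le_cycleSum {F G : ℕ → ℤ → ℝ → ℝ} {s : Finset (State K m)} {ψ : State K m → ℝ}
    (hψ : ∀ p, 0 ≤ ψ p) (h : ∀ p : State K m, F (W (stage p)) (offset p) (rate βd βc p) ≤
      G (W (stage p)) (offset p) (rate βd βc p)) :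
    cycleSum W F s ((βd, βc), ψ) ≤ cycleSum W G s ((βd, βc), ψ) :=
  Finset.sum_le_sum fun p _ => mul_le_mul_of_nonneg_left (h p) (hψ p)

theorem cycleSum_const_mul {F : ℕ → ℤ → ℝ → ℝ} {s : Finset (State K m)}
    (c : ℝ) (y : (ℝ × ℝ) × (State K m → ℝ)) :
    cycleSum W (fun w d β => c * F w d β) s y = c * cycleSum W F s y := by
  simp only [cycleSum, Finset.mul_sum]
  exact Finset.sum_congr rfl fun p _ => by ring

section Bounds

variable {ψ : State K m → ℝ}

theorem cycleSum_meanFirst_bounds (hW : ∀ s, 1 ≤ W s) (hmax : ∀ s, W s ≤ W (Fin.last K))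
    (hlast : 2 ≤ W (Fin.last K)) (hd : βd ∈ Set.Ioc (0 : ℝ) 1) (hc : βc ∈ Set.Ioc (0 : ℝ) 1)
    (hψ : IsStationary (transition W βd βc) ψ) :
    0 < cycleSum W (meanFirst m) (Finset.univ.erase none) ((βd, βc), ψ) ∧
    cycleSum W (fun w d β => 1 - probInterrupted m w d β) (Finset.univ.erase none)
        ((βd, βc), ψ) < cycleSum W (meanFirst m) (Finset.univ.erase none) ((βd, βc), ψ) ∧
    cycleSum W (meanFirst m) (Finset.univ.erase none) ((βd, βc), ψ) ≤
      W (Fin.last K) * cycleSum W (fun w d β => 1 - probInterrupted m w d β)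
        (Finset.univ.erase none) ((βd, βc), ψ) := by
  have hr := fun p : State K m => rate_mem hd hc p
  have h1 : ∀ p : State K m, 0 ≤ 1 - probInterrupted m (W (stage p)) (offset p)
      (rate βd βc p) := fun p =>
    (by positivity : (0 : ℝ) ≤ 1 / W (stage p)).trans
      (one_div_le_one_sub_probInterrupted (hW _) (offset_le p) (hr p).2)
  obtain ⟨d, hpos⟩ := hψ.exists_stage_pos hW hd hc (Fin.last K)
  have hlt : cycleSum W (fun w d β => 1 - probInterrupted m w d β) (Finset.univ.erase none)
        ((βd, βc), ψ) < cycleSum W (meanFirst m) (Finset.univ.erase none) ((βd, βc), ψ) :=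
    Finset.sum_lt_sum (fun p _ => mul_le_mul_of_nonneg_left
        (le_meanFirst (hW _) (offset_le p) (hr p).2) (hψ.1.1 p))
      ⟨some (Fin.last K, d), by simp, mul_lt_mul_of_pos_left
        (lt_meanFirst hlast (offset_le (some (Fin.last K, d))) (hr (some (Fin.last K, d))).2)
        hpos⟩
  refine ⟨lt_of_le_of_lt (Finset.sum_nonneg fun p _ => mul_nonneg (hψ.1.1 p) (h1 p)) hlt, hlt, ?_⟩
  rw [← cycleSum_const_mul]
  refine cycleSum_le_cycleSum hψ.1.1 fun p =>
    (meanFirst_le (hW _) (offset_le p) (hr p).2).trans ?_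
  exact mul_le_mul_of_nonneg_right (by exact_mod_cast hmax _) (h1 p)

theorem rateAfterCollision_mem (hW : ∀ s, 1 ≤ W s) (hmax : ∀ s, W s ≤ W (Fin.last K))
    (hlast : 2 ≤ W (Fin.last K)) (hd : βd ∈ Set.Ioc (0 : ℝ) 1) (hc : βc ∈ Set.Ioc (0 : ℝ) 1)
    (hψ : IsStationary (transition W βd βc) ψ) :
    rateAfterCollision W ((βd, βc), ψ) ∈ Set.Ico (1 / (W (Fin.last K) : ℝ)) 1 := by
  obtain ⟨h0, h1, h2⟩ := cycleSum_meanFirst_bounds hW hmax hlast hd hc hψ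
  exact ⟨(div_mem_Icc_one_div (by positivity) h1.le h2 h0).1, (div_lt_one h0).2 h1⟩

/-- Positivity comes from the state `(K, m)`: it carries mass because `βc < 1`, and it can be
interrupted because `W_K ≥ 2`. -/
theorem cycleSum_meanResidual_bounds (hW : ∀ s, 1 ≤ W s) (hmax : ∀ s, W s ≤ W (Fin.last K))
    (hlast : 2 ≤ W (Fin.last K)) (hd : βd ∈ Set.Ioc (0 : ℝ) 1) (hc : βc ∈ Set.Ioo (0 : ℝ) 1)
    (hψ : IsStationary (transition W βd βc) ψ) :
    0 < cycleSum W (meanResidual m) Finset.univ ((βd, βc), ψ) ∧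
    cycleSum W (probInterrupted m) Finset.univ ((βd, βc), ψ) ≤
      cycleSum W (meanResidual m) Finset.univ ((βd, βc), ψ) ∧
    cycleSum W (meanResidual m) Finset.univ ((βd, βc), ψ) ≤
      W (Fin.last K) * cycleSum W (probInterrupted m) Finset.univ ((βd, βc), ψ) := by
  have hr := fun p : State K m => rate_mem hd (Set.Ioo_subset_Ioc_self hc) p
  have h1 : ∀ p : State K m, 0 ≤ probInterrupted m (W (stage p)) (offset p) (rate βd βc p) :=
    fun p => probInterrupted_nonneg (hr p).1.le (hr p).2
  have hle : cycleSum W (probInterrupted m) Finset.univ ((βd, βc), ψ) ≤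
      cycleSum W (meanResidual m) Finset.univ ((βd, βc), ψ) :=
    cycleSum_le_cycleSum hψ.1.1 fun p => le_meanResidual (hr p).1.le (hr p).2
  refine ⟨lt_of_lt_of_le (Finset.sum_pos' (fun p _ => mul_nonneg (hψ.1.1 p) (h1 p))
    ⟨_, Finset.mem_univ _, mul_pos (hψ.last_offset_pos hW hd hc (Fin.last K))
      (probInterrupted_pos hlast hc.1 hc.2.le)⟩) hle, hle, ?_⟩
  rw [← cycleSum_const_mul]
  refine cycleSum_le_cycleSum hψ.1.1 fun p =>
    (meanResidual_le (offset_le p) (hr p).1.le (hr p).2).trans ?_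
  exact mul_le_mul_of_nonneg_right (by exact_mod_cast hmax _) (h1 p)

end Bounds

/-- At stationary distributions, the rate after a collision is bounded away from `1`, uniformly
in the rates. -/
theorem exists_rateAfterCollision_le (hW : ∀ s, 1 ≤ W s) (hmax : ∀ s, W s ≤ W (Fin.last K))
    (hlast : 2 ≤ W (Fin.last K)) {A : ℝ} (hA0 : 0 < A) (hA1 : A ≤ 1) :
    ∃ c < 1, ∀ βd ∈ Set.Icc A 1, ∀ βc ∈ Set.Icc A 1, ∀ ψ : State K m → ℝ,
      IsStationary (transition W βd βc) ψ → rateAfterCollision W ((βd, βc), ψ) ≤ c := by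
  let Y : Set ((ℝ × ℝ) × (State K m → ℝ)) :=
    (Set.Icc A 1 ×ˢ Set.Icc A 1) ×ˢ stdSimplex ℝ (State K m)
  let φ : (ℝ × ℝ) × (State K m → ℝ) → State K m → ℝ := fun y =>
    Matrix.vecMul y.2 (transition W y.1.1 y.1.2) - y.2
  have hIoc : Set.Icc A 1 ⊆ Set.Ioc 0 1 := fun x hx => ⟨hA0.trans_le hx.1, hx.2⟩
  have hIcc : Set.Icc A 1 ⊆ Set.Icc 0 1 := hIoc.trans Set.Ioc_subset_Icc_self
  have hY : IsCompact Y := (isCompact_Icc.prod isCompact_Icc).prod (isCompact_stdSimplex ℝ _)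
  have hφ : ContinuousOn φ Y := by
    refine ContinuousOn.sub (continuousOn_pi.2 fun q => ?_) continuousOn_snd
    refine continuousOn_finsetSum _ fun p _ => ContinuousOn.mul (by fun_prop) ?_
    exact (continuousOn_transition (hW 0) p q).comp continuousOn_fst
      fun y hy => ⟨hy.1.1.2, trivial⟩
  have hZ : IsCompact (Y ∩ φ ⁻¹' {0}) := hY.of_isClosed_subset
    (hφ.preimage_isClosed_of_isClosed hY.isClosed isClosed_singleton) Set.inter_subset_left
  have hst : ∀ y ∈ Y ∩ φ ⁻¹' {0}, IsStationary (transition W y.1.1 y.1.2) y.2 :=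
    fun y hy => ⟨hy.1.2, sub_eq_zero.1 hy.2⟩
  have hcont : ContinuousOn (rateAfterCollision W) (Y ∩ φ ⁻¹' {0}) := by
    refine ContinuousOn.div (continuous_cycleSum (fun _ _ =>
        continuous_const.sub continuous_probInterrupted) _).continuousOn
      (continuous_cycleSum (fun _ _ => continuous_meanFirst) _).continuousOn fun y hy => ?_
    exact (cycleSum_meanFirst_bounds hW hmax hlast (hIoc hy.1.1.1) (hIoc hy.1.1.2)
      (hst y hy)).1.ne'
  have hne : (Y ∩ φ ⁻¹' {0}).Nonempty := by
    have h1 : (1 : ℝ) ∈ Set.Icc A 1 := ⟨hA1, le_rfl⟩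
    obtain ⟨ψ, hψ⟩ := exists_isStationary
      (transition_nonneg (m := m) hW (hIcc h1) (hIcc h1)) (sum_transition hW)
    exact ⟨((1, 1), ψ), ⟨⟨h1, h1⟩, hψ.1⟩, sub_eq_zero.2 hψ.2⟩
  -- The constant is the maximum over the compact set, and each value on that set is strictly below
  -- `1`.
  obtain ⟨y, hy, hymax⟩ := hZ.exists_isMaxOn hne hcont
  exact ⟨_, (rateAfterCollision_mem hW hmax hlast (hIoc hy.1.1.1) (hIoc hy.1.1.2) (hst y hy)).2,
    fun βd hd βc hc ψ hψ => hymax ⟨⟨⟨hd, hc⟩, hψ.1⟩, sub_eq_zero.2 hψ.2⟩⟩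

end

end DCF

/-! ### The fixed point -/

open DCF in
theorem theorem2 (K m : ℕ) (W : Fin (K + 1) → ℕ)
    (hpos : ∀ s, 1 ≤ W s) (hmax : ∀ s, W s ≤ W (Fin.last K)) (hlast : 2 ≤ W (Fin.last K)) :
    ∃ βd ∈ Set.Icc (1 / (W (Fin.last K) : ℝ)) 1, ∃ βc ∈ Set.Icc (1 / (W (Fin.last K) : ℝ)) 1,
      DCF.IsFixedPoint K m W βd βc := by
  set A : ℝ := 1 / (W (Fin.last K) : ℝ) with hA
  have hA0 : 0 < A := by positivity
  have hA1 : A ≤ 1 := div_le_one_of_le₀ (by exact_mod_cast hpos _) (by positivity)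
  obtain ⟨c, hc1, hcle⟩ := exists_rateAfterCollision_le (m := m) hpos hmax hlast hA0 hA1
  let B : Set (ℝ × ℝ) := Set.Icc A 1 ×ˢ Set.Icc A c
  have hBd : ∀ x ∈ B, x.1 ∈ Set.Ioc (0 : ℝ) 1 := fun x hx => ⟨hA0.trans_le hx.1.1, hx.1.2⟩
  have hBc : ∀ x ∈ B, x.2 ∈ Set.Ioo (0 : ℝ) 1 := fun x hx =>
    ⟨hA0.trans_le hx.2.1, hx.2.2.trans_lt hc1⟩
  have hBd' := fun x hx => Set.Ioc_subset_Icc_self (hBd x hx)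
  have hBc' := fun x hx => Set.Ioo_subset_Icc_self (hBc x hx)
  -- Stationary distributions are chosen on the full square, beyond `B`, so that one at `(1, 1)` can
  -- be used to prove `A ≤ c`.
  have hex : ∀ x : ℝ × ℝ, ∃ ψ : State K m → ℝ,
      x ∈ Set.Icc A 1 ×ˢ Set.Icc A 1 → IsStationary (transition W x.1 x.2) ψ := fun x => by
    by_cases hx : x ∈ Set.Icc A 1 ×ˢ Set.Icc A 1
    · obtain ⟨ψ, hψ⟩ := exists_isStationary (transition_nonneg (m := m) hpos
        ⟨hA0.le.trans hx.1.1, hx.1.2⟩ ⟨hA0.le.trans hx.2.1, hx.2.2⟩) (sum_transition hpos)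
      exact ⟨ψ, fun _ => hψ⟩
    · exact ⟨0, fun h => absurd h hx⟩
  choose ψ hψ' using hex
  have hψ : ∀ x ∈ B, IsStationary (transition W x.1 x.2) (ψ x) := fun x hx =>
    hψ' x ⟨hx.1, hx.2.1, hx.2.2.trans hc1.le⟩
  have huniq : ∀ x ∈ B, ∀ φ, IsStationary (transition W x.1 x.2) φ → φ = ψ x := fun x hx φ hφ =>
    (hψ x hx).eq_of_forall_pos (transition_nonneg hpos (hBd' x hx) (hBc' x hx))
      (sum_transition hpos)
      (fun p hp => transition_none_pos hpos (hBd' x hx) (hBc' x hx) (hBc x hx).2 hp) hφ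
  have hψc : ContinuousOn ψ B := continuousOn_of_isStationary
    (fun p q => (continuousOn_transition (hpos 0) p q).mono fun x hx => ⟨hx.1.2, trivial⟩) hψ huniq
  have hpair : ContinuousOn (fun x => (x, ψ x)) B := continuousOn_id.prodMk hψc
  have hAc : A ≤ c := by
    have h1 : (1 : ℝ) ∈ Set.Icc A 1 := ⟨hA1, le_rfl⟩
    have hs := hψ' (1, 1) ⟨h1, h1⟩
    exact (rateAfterCollision_mem hpos hmax hlast (by simp) (by simp) hs).1.trans
      (hcle 1 h1 1 h1 _ hs)
  have hresid := fun x (hx : x ∈ B) =>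
    cycleSum_meanResidual_bounds hpos hmax hlast (hBd x hx) (hBc x hx) (hψ x hx)
  have hfirst := fun x (hx : x ∈ B) => cycleSum_meanFirst_bounds hpos hmax hlast (hBd x hx)
    (Set.Ioo_subset_Ioc_self (hBc x hx)) (hψ x hx)
  obtain ⟨x, hx, hfx, hgx⟩ := exists_fixedPoint_rectangle hA1 hAc
    (f := fun x => rateAfterSuccess W (x, ψ x)) (g := fun x => rateAfterCollision W (x, ψ x))
    (((continuous_cycleSum (fun _ _ => continuous_probInterrupted) _).comp_continuousOn hpair).div
      ((continuous_cycleSum (fun _ _ => continuous_meanResidual) _).comp_continuousOn hpair)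
      fun x hx => (hresid x hx).1.ne')
    (((continuous_cycleSum (fun _ _ => continuous_const.sub
        continuous_probInterrupted) _).comp_continuousOn hpair).div
      ((continuous_cycleSum (fun _ _ => continuous_meanFirst) _).comp_continuousOn hpair)
      fun x hx => (hfirst x hx).1.ne')
    (fun x hx => div_mem_Icc_one_div (by positivity) (hresid x hx).2.1 (hresid x hx).2.2
      (hresid x hx).1)
    (fun x hx => ⟨(rateAfterCollision_mem hpos hmax hlast (hBd x hx)
        (Set.Ioo_subset_Ioc_self (hBc x hx)) (hψ x hx)).1,
      hcle _ hx.1 _ ⟨hx.2.1, hx.2.2.trans hc1.le⟩ _ (hψ x hx)⟩)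
  exact ⟨x.1, hx.1, x.2, ⟨hx.2.1, hx.2.2.trans hc1.le⟩, ψ x, hψ x hx, huniq x hx, hfx.symm,
    hgx.symm⟩
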